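/- Let $A$ be a scalar type spectral operator, with domain $D(A)$, in a complex Banach space $X$, let $0\le\beta<\infty$, and let $I\subseteq[0,\infty)$ be an interval containing more than one point. (That is, there is a strongly countably additive spectral measure $E_A$ on the Borel sets of $\mathbb C$, with values in the bounded projections on $X$, $E_A(\mathbb C)=\mathrm{Id}$ and $E_A(\delta\cap\sigma)=E_A(\delta)E_A(\sigma)$, whose support is the spectrum $\sigma(A)$, such that $A=\int_{\sigma(A)}\lambda\,dE_A(\lambda)$, i.e. $D(A)$ is the set of $f\in X$ for which $\lim_{n\to\infty}\int_{\{\lambda\in\sigma(A):|\lambda|\le n\}}\lambda\,dE_A(\lambda)f$ exists, and $Af$ is this limit. Such an $A$ is closed and densely defined.) Let $y:[0,\infty)\to X$ be a weak solution of $y'(t)=Ay(t)$, $t\ge0$: $y$ is continuous in norm and, for every $g^*$ in the domain of the adjoint $A^*$ and every $t\ge0$, $\frac{d}{dt}\langle y(t),g^*\rangle=\langle y(t),A^*g^*\rangle$ (a one-sided derivative at $t=0$). Let $\mathscr E^{\{\beta\}}(I,X)$ (resp. $\mathscr E^{(\beta)}(I,X)$) be the set of functions $g:I\to X$ that are infinitely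 differentiable in norm on $I$ (one-sidedly at endpoints of $I$) and such that for every $[a,b]\subseteq I$ there are $\alpha>0$ and $c>0$ (resp. for every $[a,b]\subseteq I$ and every $\alpha>0$ there is $c>0$) with $$\max_{a\le t\le b}\|g^{(n)}(t)\|\le c\,\alpha^n(n!)^\beta,\qquad n=0,1,2,\dots$$ Let $\mathscr E^{\{\beta\}}(A)$ (resp. $\mathscr E^{(\beta)}(A)$) be the set of $x\in\bigcap_{n\ge0}D(A^n)$ such that there are $\alpha>0$ and $c>0$ (resp. for every $\alpha>0$ there is $c>0$) with $\|A^nx\|\le c\,\alpha^n(n!)^\beta$ for $n=0,1,2,\dots$ Then the restriction of $y$ to $I$ belongs to $\mathscr E^{\{\beta\}}(I,X)$ if and only if $y(t)\in\mathscr E^{\{\beta\}}(A)$ for each $t\in I$; likewise, the restriction of $y$ to $I$ belongs to $\mathscr E^{(\beta)}(I,X)$ if and only if $y(t)\in\mathscr E^{(\beta)}(A)$ for each $t\in I$. In either case, for all $n\in\mathbb N$ and $t\in I$, $y(t)\in D(A^n)$ and $$y^{(n)}(t)=A^ny(t),$$ where $y^{(n)}$ is the $n$th derivative of $y$ on $I$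 (one-sided at endpoints of $I$). -/

import Mathlib

open Set Filter Topology MeasureTheory
open scoped ContDiff

noncomputable section

namespace Gevrey

variable {X : Type*} [NormedAddCommGroup X] [NormedSpace ℂ X]

/-! ### Unbounded operators: composition, powers, spectrum -/

/-- The product `B A` of two (unbounded) operators, on its maximal domain
`{x ∈ D(A) | A x ∈ D(B)}`. -/
def opMul (B A : X →ₗ.[ℂ] X) : X →ₗ.[ℂ] X where
  domain := (B.domain.comap A.toFun).map A.domain.subtype
  toFun :=
    { toFun := fun x => B ⟨A ⟨x, by obtain ⟨z, -, hz⟩ := x.2; rw [← hz]; exact z.2⟩, by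
        obtain ⟨x, z, hz, rfl⟩ := x; exact hz⟩
      map_add' := fun x y => by
        rw [← LinearPMap.map_add]; congr 1; ext1; simp only [Submodule.coe_add]
        rw [← LinearPMap.map_add]; rfl
      map_smul' := fun c x => by
        rw [RingHom.id_apply, ← LinearPMap.map_smul]; congr 1; ext1
        simp only [Submodule.coe_smul]
        rw [← LinearPMap.map_smul]; rfl }

/-- The powers of an operator: `A ^ 0 = I` (everywhere defined) and `A ^ (n + 1) = A (A ^ n)` with
domain `{x ∈ D(A ^ n) | A ^ n x ∈ D(A)}`. -/
def opPow (A : X →ₗ.[ℂ] X) : ℕ → (X →ₗ.[ℂ] X)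
  | 0 => (LinearMap.id : X →ₗ[ℂ] X).toPMap ⊤
  | n + 1 => opMul A (opPow A n)

/-- `z` is in the resolvent set of `A`: the operator `z I - A : D(A) → X` has a bounded,
everywhere defined two-sided inverse `R`. -/
def IsResolventPoint (A : X →ₗ.[ℂ] X) (z : ℂ) : Prop :=
  ∃ R : X →L[ℂ] X,
    (∀ x : X, ∃ h : R x ∈ A.domain, z • R x - A ⟨R x, h⟩ = x) ∧
    ∀ x : A.domain, R (z • (x : X) - A x) = x

/-- The spectrum `σ(A)` of an unbounded operator. -/
def opSpectrum (A : X →ₗ.[ℂ] X) : Set ℂ := {z | ¬ IsResolventPoint A z}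

/-! ### Spectral measures and scalar type spectral operators -/

variable (X) in
/-- A strongly countably additive, projection-valued measure on the Borel sets of the complex
plane. Values on non-Borel sets are irrelevant. (Each `E δ` is a projection, by `inter` with
`s = t`; `E ∅ = 0`, by `hasSum` with empty sets; uniform boundedness is automatic.) -/
structure SpectralMeasure where
  /-- the projection assigned to a Borel set -/
  proj : Set ℂ → X →L[ℂ] X
  univ : proj univ = ContinuousLinearMap.id ℂ X
  inter : ∀ s t : Set ℂ, MeasurableSet s → MeasurableSet t →
    proj (s ∩ t) = (proj s).comp (proj t)
  hasSum : ∀ δ : ℕ → Set ℂ, (∀ n, MeasurableSet (δ n)) → Pairwise (Function.onFun Disjoint δ) →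
    ∀ x : X, HasSum (fun n => proj (δ n) x) (proj (⋃ n, δ n) x)

namespace SpectralMeasure

/-- The (closed) support of a spectral measure. -/
def support (E : SpectralMeasure X) : Set ℂ :=
  {z | ∀ U : Set ℂ, IsOpen U → z ∈ U → E.proj U ≠ 0}

/-- `∫ φ dE = ∑ c E(φ = c)` for a simple Borel function `φ`. -/
def simpleIntegral (E : SpectralMeasure X) (φ : SimpleFunc ℂ ℂ) : X →L[ℂ] X :=
  ∑ c ∈ φ.range, c • E.proj (φ ⁻¹' {c})

/-- `T = ∫ F dE` for a bounded Borel function `F`: `T` is the limit in operator norm of the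
integrals of simple functions converging uniformly to `F`. -/
def HasBoundedIntegral (E : SpectralMeasure X) (F : ℂ → ℂ) (T : X →L[ℂ] X) : Prop :=
  ∃ φ : ℕ → SimpleFunc ℂ ℂ, TendstoUniformly (fun n z => φ n z) F atTop ∧
    Tendsto (fun n => E.simpleIntegral (φ n)) atTop (𝓝 T)

/-- `x` is in the domain of the (possibly unbounded) operator `∫ F dE`, and `(∫ F dE) x = y`:
the truncations `Fₙ = F · χ_{|F| ≤ n}` satisfy `(∫ Fₙ dE) x → y`. -/
def HasIntegralAt (E : SpectralMeasure X) (F : ℂ → ℂ) (x y : X) : Prop :=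
  ∃ T : ℕ → X →L[ℂ] X,
    (∀ n : ℕ, E.HasBoundedIntegral ({z | ‖F z‖ ≤ n}.indicator F) (T n)) ∧
    Tendsto (fun n => T n x) atTop (𝓝 y)

end SpectralMeasure

/-- `A` is a scalar type spectral operator with spectral measure (resolution of the identity) `E`:
the support of `E` is the spectrum of `A`, and `A = ∫ z dE(z)`, domains included.
(Such an operator is automatically closed and densely defined.) -/
structure IsSpectralMeasureOf (E : SpectralMeasure X) (A : X →ₗ.[ℂ] X) : Prop where
  support_eq : E.support = opSpectrum A
  mem_graph_iff : ∀ x y : X, (x, y) ∈ A.graph ↔ E.HasIntegralAt (fun z => z) x y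

/-! ### Weak solutions -/

/-- `g ∈ D(A*)` and `A* g = h` for the (Banach space) adjoint `A*` of a densely defined
operator `A`. -/
def HasAdjointAt (A : X →ₗ.[ℂ] X) (g h : StrongDual ℂ X) : Prop :=
  ∀ x : A.domain, g (A x) = h x

/-- `y : [0, ∞) → X` is a weak solution of `y' = A y`: it is continuous, and
`d/dt ⟨y(t), g⟩ = ⟨y(t), A* g⟩` on `[0, ∞)` for every `g ∈ D(A*)` (one-sided derivative at `0`).
Only the values of `y` on `[0, ∞)` matter. -/
def IsWeakSolution (A : X →ₗ.[ℂ] X) (y : ℝ → X) : Prop :=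
  ContinuousOn y (Ici 0) ∧
    ∀ g h : StrongDual ℂ X, HasAdjointAt A g h →
      ∀ t ∈ Ici (0 : ℝ), HasDerivWithinAt (fun s => g (y s)) (h (y t)) (Ici 0) t

/-! ### Gevrey classes of functions -/

/-- The Gevrey class of order `β` of Roumieu type on the interval `I` (for functions on `ℝ` of
which only the restriction to `I` matters; derivatives are one-sided at endpoints of `I`). -/
def gevreyRoumieuOn (β : ℝ) (I : Set ℝ) : Set (ℝ → X) :=
  {g | ContDiffOn ℝ ∞ g I ∧ ∀ a b : ℝ, Icc a b ⊆ I → ∃ α > (0 : ℝ), ∃ c > (0 : ℝ),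
    ∀ n : ℕ, ∀ t ∈ Icc a b, ‖iteratedDerivWithin n g I t‖ ≤ c * α ^ n * (n.factorial : ℝ) ^ β}

/-- The Gevrey class of order `β` of Beurling type on the interval `I`. -/
def gevreyBeurlingOn (β : ℝ) (I : Set ℝ) : Set (ℝ → X) :=
  {g | ContDiffOn ℝ ∞ g I ∧ ∀ a b : ℝ, Icc a b ⊆ I → ∀ α > (0 : ℝ), ∃ c > (0 : ℝ),
    ∀ n : ℕ, ∀ t ∈ Icc a b, ‖iteratedDerivWithin n g I t‖ ≤ c * α ^ n * (n.factorial : ℝ) ^ β}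

/-! ### Gevrey classes of vectors -/

/-- The Gevrey class of order `β` of Roumieu type of vectors of `A`, a subset of
`C^∞(A) = ⋂ₙ D(A ^ n)`. -/
def gevreyRoumieuVec (β : ℝ) (A : X →ₗ.[ℂ] X) : Set X :=
  {x | ∃ hx : ∀ n : ℕ, x ∈ (opPow A n).domain, ∃ α > (0 : ℝ), ∃ c > (0 : ℝ),
    ∀ n : ℕ, ‖opPow A n ⟨x, hx n⟩‖ ≤ c * α ^ n * (n.factorial : ℝ) ^ β}

/-- The Gevrey class of order `β` of Beurling type of vectors of `A`. -/
def gevreyBeurlingVec (β : ℝ) (A : X →ₗ.[ℂ] X) : Set X :=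
  {x | ∃ hx : ∀ n : ℕ, x ∈ (opPow A n).domain, ∀ α > (0 : ℝ), ∃ c > (0 : ℝ),
    ∀ n : ℕ, ‖opPow A n ⟨x, hx n⟩‖ ≤ c * α ^ n * (n.factorial : ℝ) ^ β}

end Gevrey

end

/-! Write `P k` for the spectral projection of the disc `‖z‖ ≤ k` and `T k` for the bounded operator
`∫ z dE` over that disc (`truncProj`, `truncOp`). Since `P k → 1` strongly and `P k A ⊆ T k`, a pair
`(x, v)` lies in the graph of `A` exactly when `T k x = P k v` for all `k`, so questions about `A`
reduce to bounded operators, provided the estimates are uniform in `k`.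

If `y` is a weak solution, then `u = P k y`, and likewise `u = (T k)^n P k y`, solves `u' = T k u`
in norm, so `u t = exp ((t - s) T k) (u s)`. On the spectral subspace `Re z ≤ 0` the exponential is
bounded forward in time, on `Re z > 0` backward. Hence `‖u t‖ ≤ C (‖u a‖ + ‖u b‖)` for `a ≤ t ≤ b`,
with `C` depending only on `E` (`exists_norm_le_of_hasDerivWithinAt_truncOp`).

As `k → ∞` this becomes `‖A^n y(t)‖ ≤ C (‖A^n y(a)‖ + ‖A^n y(b)‖)` with `C` independent of `n`:
Gevrey bounds at the two endpoints spread over `[a, b]`. The same estimate at order `n + 2` controls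
Taylor remainders and gives smoothness from pointwise membership in the domains
(`contDiffOn_of_mem_domain_opPow`). Conversely, smoothness gives `y^(n) = A^n y` through the graph
criterion (`mem_graph_opPow_iteratedDerivWithin`). -/

namespace Gevrey

variable {X : Type*} [NormedAddCommGroup X] [NormedSpace ℂ X]

/-! ### Spectral measures and integrals of simple functions. -/

namespace SpectralMeasure

variable (E : SpectralMeasure X)

theorem proj_empty : E.proj ∅ = 0 := by
  ext x
  have h := E.hasSum (fun _ => ∅) (fun _ => .empty) (fun _ _ _ => disjoint_bot_left) x
  simpa using (summable_const_iff (β := ℕ) (a := E.proj ∅ x)).1 (by simpa using h.summable)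

open Classical in
/-- The vector measure `δ ↦ E δ x`. -/
noncomputable def vectorMeasure (x : X) : VectorMeasure ℂ X where
  measureOf' s := if MeasurableSet s then E.proj s x else 0
  empty' := by simp [E.proj_empty]
  not_measurable' s hs := if_neg hs
  m_iUnion' f hf hd := by
    simpa [hf, MeasurableSet.iUnion hf] using E.hasSum f hf hd x

theorem vectorMeasure_apply (x : X) {s : Set ℂ} (hs : MeasurableSet s) :
    E.vectorMeasure x s = E.proj s x := if_pos hs

/-- Each vector measure `δ ↦ E δ x` has bounded range, so Banach–Steinhaus applies. -/
theorem exists_norm_proj_le [CompleteSpace X] :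
    ∃ M, 0 ≤ M ∧ ∀ s, MeasurableSet s → ‖E.proj s‖ ≤ M := by
  obtain ⟨M, hM⟩ := banach_steinhaus (g := fun s : {s : Set ℂ // MeasurableSet s} => E.proj s)
    fun x => ⟨(E.vectorMeasure x).bound, fun s => by
      rw [← E.vectorMeasure_apply x s.2]; exact VectorMeasure.norm_apply_le_bound⟩
  exact ⟨M, (norm_nonneg _).trans (hM ⟨∅, .empty⟩), fun s hs => hM ⟨s, hs⟩⟩

theorem proj_preimage_finset {α : Type*} (ψ : SimpleFunc ℂ α) (S : Finset α) :
    E.proj (ψ ⁻¹' S) = ∑ a ∈ S, E.proj (ψ ⁻¹' {a}) := by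
  ext x
  have h := (E.vectorMeasure x).of_biUnion_finset (s := S) (f := fun a => ψ ⁻¹' {a})
    (fun a _ b _ hab => (disjoint_singleton.2 hab).preimage ψ) (fun a _ => ψ.measurableSet_fiber a)
  rw [show (⋃ b ∈ S, ψ ⁻¹' {b}) = ψ ⁻¹' S by ext; simp,
    E.vectorMeasure_apply x (ψ.measurableSet_preimage _)] at h
  simp only [E.vectorMeasure_apply x (ψ.measurableSet_fiber _)] at h
  simpa using h

/-- Applied to `φ.pair ψ`, this puts two integrals over a common partition, where sums, differences
and products are computed termwise. -/
theorem simpleIntegral_map {α : Type*} (ψ : SimpleFunc ℂ α) (f : α → ℂ) :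
    E.simpleIntegral (ψ.map f) = ∑ a ∈ ψ.range, f a • E.proj (ψ ⁻¹' {a}) := by
  classical
  rw [simpleIntegral, SimpleFunc.range_map]
  rw [← Finset.sum_fiberwise_of_maps_to (g := f) (t := ψ.range.image f)
    (fun a ha => Finset.mem_image_of_mem f ha)]
  refine Finset.sum_congr rfl fun c _ => ?_
  rw [SimpleFunc.map_preimage_singleton, proj_preimage_finset, Finset.smul_sum]
  refine Finset.sum_congr rfl fun a ha => ?_
  rw [(Finset.mem_filter.1 ha).2]

theorem simpleIntegral_sub (φ ψ : SimpleFunc ℂ ℂ) :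
    E.simpleIntegral (φ - ψ) = E.simpleIntegral φ - E.simpleIntegral ψ := by
  have h₁ := E.simpleIntegral_map (φ.pair ψ) Prod.fst
  have h₂ := E.simpleIntegral_map (φ.pair ψ) Prod.snd
  have h₃ := E.simpleIntegral_map (φ.pair ψ) fun p => p.1 - p.2
  rw [SimpleFunc.map_fst_pair] at h₁
  rw [SimpleFunc.map_snd_pair] at h₂
  rw [h₁, h₂, ← Finset.sum_sub_distrib]
  simp only [← sub_smul]
  exact h₃

theorem simpleIntegral_add (φ ψ : SimpleFunc ℂ ℂ) :
    E.simpleIntegral (φ + ψ) = E.simpleIntegral φ + E.simpleIntegral ψ := by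
  rw [← sub_eq_iff_eq_add, ← simpleIntegral_sub, add_sub_cancel_right]

theorem simpleIntegral_mul (φ ψ : SimpleFunc ℂ ℂ) :
    E.simpleIntegral (φ * ψ) = E.simpleIntegral φ * E.simpleIntegral ψ := by
  have h₁ := E.simpleIntegral_map (φ.pair ψ) Prod.fst
  have h₂ := E.simpleIntegral_map (φ.pair ψ) Prod.snd
  have h₃ := E.simpleIntegral_map (φ.pair ψ) fun p => p.1 * p.2
  rw [SimpleFunc.map_fst_pair] at h₁
  rw [SimpleFunc.map_snd_pair] at h₂
  rw [h₁, h₂, Finset.sum_mul_sum]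
  refine h₃.trans (Finset.sum_congr rfl fun p hp => ?_)
  rw [Finset.sum_eq_single_of_mem p hp]
  · rw [smul_mul_smul_comm, ContinuousLinearMap.mul_def,
      ← E.inter _ _ (SimpleFunc.measurableSet_fiber _ _) (SimpleFunc.measurableSet_fiber _ _), inter_self]
  · intro q _ hq
    rw [smul_mul_smul_comm, ContinuousLinearMap.mul_def,
      ← E.inter _ _ (SimpleFunc.measurableSet_fiber _ _) (SimpleFunc.measurableSet_fiber _ _),
      ← preimage_inter, singleton_inter_eq_empty.2 (by simpa using hq.symm), preimage_empty, E.proj_empty, smul_zero]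

theorem simpleIntegral_const (c : ℂ) :
    E.simpleIntegral (SimpleFunc.const ℂ c) = c • ContinuousLinearMap.id ℂ X := by
  rw [simpleIntegral, SimpleFunc.range_const]
  simp [show Function.const ℂ c ⁻¹' {c} = Set.univ by ext; simp, E.univ]

theorem simpleIntegral_indicator {s : Set ℂ} (hs : MeasurableSet s) :
    E.simpleIntegral (SimpleFunc.piecewise s hs (SimpleFunc.const ℂ 1) (SimpleFunc.const ℂ 0)) =
      E.proj s := by
  rw [simpleIntegral]
  rw [Finset.sum_subset (s₂ := {0, 1})]
  · rw [Finset.sum_pair zero_ne_one, zero_smul, zero_add, one_smul]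
    congr 1
    ext z
    by_cases hz : z ∈ s <;> simp [hz]
  · intro c hc
    obtain ⟨z, rfl⟩ := SimpleFunc.mem_range.1 hc
    by_cases hz : z ∈ s <;> simp [hz]
  · intro c _ hc
    rw [(SimpleFunc.preimage_eq_empty_iff _ c).2 hc, E.proj_empty, smul_zero]

/-- Grouping the terms by sign turns each group into the value of `l` on a single projection, of
size at most `M * ‖x‖`. -/
theorem sum_abs_dual_le {M : ℝ} (hM : ∀ s, MeasurableSet s → ‖E.proj s‖ ≤ M)
    (φ : SimpleFunc ℂ ℂ) (x : X) (l : StrongDual ℝ X) (hl : ‖l‖ ≤ 1) :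
    ∑ c ∈ φ.range, |l (E.proj (φ ⁻¹' {c}) x)| ≤ 2 * M * ‖x‖ := by
  have key (S : Finset ℂ) : |∑ c ∈ S, l (E.proj (φ ⁻¹' {c}) x)| ≤ M * ‖x‖ := by
    rw [← map_sum, ← _root_.sum_apply, ← proj_preimage_finset]
    calc _ ≤ 1 * ‖E.proj (φ ⁻¹' S) x‖ := l.le_of_opNorm_le hl _
      _ ≤ M * ‖x‖ := by
        rw [one_mul]
        exact (E.proj _).le_of_opNorm_le (hM _ (φ.measurableSet_preimage _)) _
  rw [← Finset.sum_filter_add_sum_filter_not _ fun c => 0 ≤ l (E.proj (φ ⁻¹' {c}) x)]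
  have h₁ := key (φ.range.filter fun c => 0 ≤ l (E.proj (φ ⁻¹' {c}) x))
  have h₂ := key (φ.range.filter fun c => ¬ 0 ≤ l (E.proj (φ ⁻¹' {c}) x))
  rw [Finset.sum_congr rfl fun c hc => abs_of_nonneg (Finset.mem_filter.1 hc).2,
    Finset.sum_congr (g := fun c => -l (E.proj (φ ⁻¹' {c}) x)) rfl
      fun c hc => abs_of_neg (not_le.1 (Finset.mem_filter.1 hc).2), Finset.sum_neg_distrib]
  linarith [le_abs_self (∑ c ∈ φ.range.filter fun c => 0 ≤ l (E.proj (φ ⁻¹' {c}) x), l (E.proj (φ ⁻¹' {c}) x)),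
    neg_le_abs (∑ c ∈ φ.range.filter fun c => ¬ 0 ≤ l (E.proj (φ ⁻¹' {c}) x), l (E.proj (φ ⁻¹' {c}) x))]

/-- A real norming functional reduces this to `sum_abs_dual_le`, used once for the real parts of the
coefficients at `x` and once for the imaginary parts at `Complex.I • x`; each contributes `2 * M *
B`. -/
theorem norm_simpleIntegral_le {M : ℝ} (hM0 : 0 ≤ M)
    (hM : ∀ s, MeasurableSet s → ‖E.proj s‖ ≤ M)
    (φ : SimpleFunc ℂ ℂ) {B : ℝ} (hB0 : 0 ≤ B) (hB : ∀ z, ‖φ z‖ ≤ B) :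
    ‖E.simpleIntegral φ‖ ≤ 4 * M * B := by
  refine ContinuousLinearMap.opNorm_le_bound _ (by positivity) fun x => ?_
  obtain ⟨l, hl, hlx⟩ := exists_dual_vector'' ℝ (E.simpleIntegral φ x)
  have hlx' : l (E.simpleIntegral φ x) = ‖E.simpleIntegral φ x‖ := hlx
  have hsum : l (E.simpleIntegral φ x) = ∑ c ∈ φ.range,
      (c.re * l (E.proj (φ ⁻¹' {c}) x) + c.im * l (E.proj (φ ⁻¹' {c}) (Complex.I • x))) := by
    rw [simpleIntegral, _root_.sum_apply, map_sum]
    refine Finset.sum_congr rfl fun c _ => ?_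
    rw [_root_.smul_apply, map_smul (E.proj (φ ⁻¹' {c})), ← smul_eq_mul, ← smul_eq_mul, ← l.map_smul,
      ← l.map_smul, ← l.map_add]
    conv_lhs => rw [← Complex.re_add_im c]
    rw [add_smul, mul_smul, Complex.coe_smul, Complex.coe_smul, Complex.re_add_im]
  have hB' : ∀ c ∈ φ.range, ‖c‖ ≤ B := SimpleFunc.forall_mem_range.2 hB
  have h₁ := E.sum_abs_dual_le hM φ x l hl
  have h₂ := E.sum_abs_dual_le hM φ (Complex.I • x) l hl
  rw [norm_smul, Complex.norm_I, one_mul] at h₂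
  calc ‖E.simpleIntegral φ x‖ = l (E.simpleIntegral φ x) := hlx'.symm
    _ ≤ ∑ c ∈ φ.range, (B * |l (E.proj (φ ⁻¹' {c}) x)| +
          B * |l (E.proj (φ ⁻¹' {c}) (Complex.I • x))|) := by
      rw [hsum]
      refine Finset.sum_le_sum fun c hc => add_le_add ?_ ?_
      · refine (le_abs_self _).trans ?_
        rw [abs_mul]
        gcongr
        exact (Complex.abs_re_le_norm c).trans (hB' c hc)
      · refine (le_abs_self _).trans ?_
        rw [abs_mul]
        gcongr
        exact (Complex.abs_im_le_norm c).trans (hB' c hc)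
    _ ≤ 4 * M * B * ‖x‖ := by
      rw [Finset.sum_add_distrib, ← Finset.mul_sum, ← Finset.mul_sum]
      nlinarith

/-! ### Functional calculus for bounded Borel functions. -/

variable {E}

theorem hasBoundedIntegral_iff {F : ℂ → ℂ} {T : X →L[ℂ] X} :
    E.HasBoundedIntegral F T ↔ ∀ ε > 0, ∃ φ : SimpleFunc ℂ ℂ, (∀ z, ‖φ z - F z‖ < ε) ∧
      ‖E.simpleIntegral φ - T‖ < ε := by
  constructor
  · rintro ⟨φ, hφ, hT⟩ ε hε
    obtain ⟨n, h₁, h₂⟩ := ((Metric.tendstoUniformly_iff.1 hφ ε hε).and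
      (Metric.tendsto_nhds.1 hT ε hε)).exists
    exact ⟨φ n, fun z => by rw [← dist_eq_norm, dist_comm]; exact h₁ z,
      by rw [← dist_eq_norm]; exact h₂⟩
  · intro h
    choose φ h₁ h₂ using fun n : ℕ => h (1 / ((n : ℝ) + 1)) Nat.one_div_pos_of_nat
    refine ⟨φ, Metric.tendstoUniformly_iff.2 fun ε hε => ?_, Metric.tendsto_nhds.2 fun ε hε => ?_⟩
    · filter_upwards [tendsto_one_div_add_atTop_nhds_zero_nat.eventually_lt_const hε] with n hn z
      rw [dist_comm, dist_eq_norm]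
      exact (h₁ n z).trans hn
    · filter_upwards [tendsto_one_div_add_atTop_nhds_zero_nat.eventually_lt_const hε] with n hn
      rw [dist_eq_norm]
      exact (h₂ n).trans hn

theorem hasBoundedIntegral_simpleFunc (φ : SimpleFunc ℂ ℂ) :
    E.HasBoundedIntegral φ (E.simpleIntegral φ) :=
  hasBoundedIntegral_iff.2 fun ε hε => ⟨φ, by simpa using hε, by simpa using hε⟩

theorem hasBoundedIntegral_const (c : ℂ) :
    E.HasBoundedIntegral (fun _ => c) (c • ContinuousLinearMap.id ℂ X) := by
  rw [← simpleIntegral_const]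
  exact hasBoundedIntegral_simpleFunc (SimpleFunc.const ℂ c)

theorem hasBoundedIntegral_indicator {s : Set ℂ} (hs : MeasurableSet s) :
    E.HasBoundedIntegral (s.indicator fun _ => 1) (E.proj s) := by
  classical
  rw [← E.simpleIntegral_indicator hs]
  convert! hasBoundedIntegral_simpleFunc (E := E) _ using 1
  ext z
  by_cases hz : z ∈ s <;> simp [hz]

namespace HasBoundedIntegral

variable {F G : ℂ → ℂ} {T S : X →L[ℂ] X}

theorem exists_bound (h : E.HasBoundedIntegral F T) : ∃ R, 0 ≤ R ∧ ∀ z, ‖F z‖ ≤ R := by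
  obtain ⟨φ, hφ, -⟩ := hasBoundedIntegral_iff.1 h 1 one_pos
  obtain ⟨C, hC⟩ := (φ.map fun c => ‖c‖).exists_forall_le
  have hC' (z : ℂ) : ‖F z‖ ≤ C + 1 := by
    have h₁ := hC z
    have h₂ := hφ z
    rw [SimpleFunc.map_apply] at h₁
    linarith [norm_le_norm_add_norm_sub' (F z) (φ z), norm_sub_rev (F z) (φ z)]
  exact ⟨C + 1, (norm_nonneg _).trans (hC' 0), hC'⟩

theorem of_tendstoUniformly {F' : ℕ → ℂ → ℂ} {T' : ℕ → X →L[ℂ] X}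
    (h : ∀ n, E.HasBoundedIntegral (F' n) (T' n)) (hF : TendstoUniformly F' F atTop)
    (hT : Tendsto T' atTop (𝓝 T)) : E.HasBoundedIntegral F T := by
  refine hasBoundedIntegral_iff.2 fun ε hε => ?_
  obtain ⟨n, h₁, h₂⟩ := ((Metric.tendstoUniformly_iff.1 hF _ (half_pos hε)).and
      (Metric.tendsto_nhds.1 hT _ (half_pos hε))).exists
  obtain ⟨φ, hφ, hφT⟩ := hasBoundedIntegral_iff.1 (h n) _ (half_pos hε)
  refine ⟨φ, fun z => ?_, ?_⟩
  · have := h₁ z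
    rw [dist_comm, dist_eq_norm] at this
    linarith [hφ z, norm_sub_le_norm_sub_add_norm_sub (φ z) (F' n z) (F z)]
  · rw [dist_eq_norm] at h₂
    linarith [norm_sub_le_norm_sub_add_norm_sub (E.simpleIntegral φ) (T' n) T]

theorem sub (hF : E.HasBoundedIntegral F T) (hG : E.HasBoundedIntegral G S) :
    E.HasBoundedIntegral (F - G) (T - S) := by
  obtain ⟨φ, h₁, h₂⟩ := hF
  obtain ⟨ψ, h₃, h₄⟩ := hG
  refine ⟨fun n => φ n - ψ n, h₁.sub h₃, ?_⟩
  simpa only [simpleIntegral_sub] using h₂.sub h₄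

theorem add (hF : E.HasBoundedIntegral F T) (hG : E.HasBoundedIntegral G S) :
    E.HasBoundedIntegral (F + G) (T + S) := by
  obtain ⟨φ, h₁, h₂⟩ := hF
  obtain ⟨ψ, h₃, h₄⟩ := hG
  refine ⟨fun n => φ n + ψ n, h₁.add h₃, ?_⟩
  simpa only [simpleIntegral_add] using h₂.add h₄

theorem mul (hF : E.HasBoundedIntegral F T) (hG : E.HasBoundedIntegral G S) :
    E.HasBoundedIntegral (F * G) (T * S) := by
  obtain ⟨R₁, h₁, hR₁⟩ := hF.exists_bound
  obtain ⟨R₂, h₂, hR₂⟩ := hG.exists_bound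
  obtain ⟨φ, hφ, hφT⟩ := hF
  obtain ⟨ψ, hψ, hψS⟩ := hG
  refine ⟨fun n => φ n * ψ n, ?_, by simpa only [simpleIntegral_mul] using hφT.mul hψS⟩
  rw [Metric.tendstoUniformly_iff] at hφ hψ ⊢
  intro ε hε
  set R := R₁ + R₂ + 1
  -- The bound `1` keeps `‖φ n z‖ ≤ R`; the bound `ε / (2 * R)` splits the error equally between the
  -- two factors.
  have hδ : 0 < min 1 (ε / (2 * R)) := by positivity
  filter_upwards [hφ _ hδ, hψ _ hδ] with n h₃ h₄ z
  have h₅ := h₃ z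
  have h₆ := h₄ z
  rw [dist_eq_norm] at h₅ h₆ ⊢
  have h₇ : ‖φ n z‖ ≤ R := by
    have := norm_le_norm_add_norm_sub (F z) (φ n z)
    linarith [hR₁ z, min_le_left 1 (ε / (2 * R))]
  calc ‖F z * G z - φ n z * ψ n z‖
      = ‖(F z - φ n z) * G z + φ n z * (G z - ψ n z)‖ := by ring_nf
    _ ≤ ‖F z - φ n z‖ * ‖G z‖ + ‖φ n z‖ * ‖G z - ψ n z‖ := by
        simpa only [norm_mul] using norm_add_le ((F z - φ n z) * G z) (φ n z * (G z - ψ n z))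
    _ ≤ ‖F z - φ n z‖ * R + R * ‖G z - ψ n z‖ := by
        gcongr
        linarith [hR₂ z]
    _ < ε / (2 * R) * R + R * (ε / (2 * R)) := by
        have hR : 0 < R := by positivity
        have := min_le_right 1 (ε / (2 * R))
        have := mul_lt_mul_of_pos_right (h₅.trans_le this) hR
        have := mul_lt_mul_of_pos_left (h₆.trans_le ‹_›) hR
        linarith
    _ = ε := by
        have hR : R ≠ 0 := by positivity
        field_simp; ring

theorem smul (c : ℂ) (hF : E.HasBoundedIntegral F T) :
    E.HasBoundedIntegral (fun z => c * F z) (c • T) := by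
  have h := (hasBoundedIntegral_const (E := E) c).mul hF
  rwa [smul_mul_assoc, ← ContinuousLinearMap.one_def, one_mul] at h

theorem pow (hF : E.HasBoundedIntegral F T) (n : ℕ) :
    E.HasBoundedIntegral (F ^ n) (T ^ n) := by
  induction n with
  | zero => simpa [ContinuousLinearMap.one_def] using! hasBoundedIntegral_const (E := E) 1
  | succ n ih => simpa only [pow_succ] using ih.mul hF

theorem sum {ι : Type*} (s : Finset ι) {F : ι → ℂ → ℂ} {T : ι → X →L[ℂ] X}
    (h : ∀ i ∈ s, E.HasBoundedIntegral (F i) (T i)) :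
    E.HasBoundedIntegral (fun z => ∑ i ∈ s, F i z) (∑ i ∈ s, T i) := by
  classical
  induction s using Finset.induction_on with
  | empty => simpa using hasBoundedIntegral_const (E := E) 0
  | insert i s hi ih =>
    simp only [Finset.sum_insert hi]
    exact (h i (Finset.mem_insert_self _ _)).add
      (ih fun j hj => h j (Finset.mem_insert_of_mem hj))

/-- As `F` is bounded by `R`, the exponential series converges uniformly, dominated by `R ^ n / n!`.
-/
theorem exp [CompleteSpace X] (hF : E.HasBoundedIntegral F T) :
    E.HasBoundedIntegral (fun z => Complex.exp (F z)) (NormedSpace.exp T) := by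
  obtain ⟨R, -, hR⟩ := hF.exists_bound
  have hT := (NormedSpace.exp_series_hasSum_exp' (𝕂 := ℂ) T).tendsto_sum_nat
  refine of_tendstoUniformly
    (F' := fun N z => ∑ n ∈ Finset.range N, ((n.factorial : ℂ)⁻¹) * F z ^ n)
    (fun N => sum _ fun n _ => (hF.pow n).smul _) ?_ hT
  have h := tendstoUniformly_tsum_nat (f := fun n z => ((n.factorial : ℂ)⁻¹) * F z ^ n)
    (u := fun n => R ^ n / n.factorial) (Real.summable_pow_div_factorial R) fun n z => by
      rw [norm_mul, norm_inv, norm_pow, Complex.norm_natCast, inv_mul_eq_div]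
      gcongr
      exact hR z
  convert h using 2 with z
  rw [Complex.exp_eq_exp_ℂ, NormedSpace.exp_eq_tsum ℂ]
  simp [smul_eq_mul]

end HasBoundedIntegral

variable (E) in
theorem exists_norm_le_of_hasBoundedIntegral [CompleteSpace X] :
    ∃ C, 0 ≤ C ∧ ∀ (F : ℂ → ℂ) (T : X →L[ℂ] X) (B : ℝ), 0 ≤ B → E.HasBoundedIntegral F T →
      (∀ z, ‖F z‖ ≤ B) → ‖T‖ ≤ C * B := by
  obtain ⟨M, hM0, hM⟩ := E.exists_norm_proj_le
  refine ⟨4 * M, by positivity, fun F T B hB0 h hB => ?_⟩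
  refine le_of_forall_pos_le_add fun ε hε => ?_
  -- The approximation costs `4 * M * δ` in the simple-function bound and `δ` in operator norm.
  have hδ : 0 < ε / (4 * M + 1) := by positivity
  obtain ⟨φ, hφ, hφT⟩ := hasBoundedIntegral_iff.1 h _ hδ
  have h₁ := E.norm_simpleIntegral_le hM0 hM φ (B := B + ε / (4 * M + 1)) (by positivity)
    fun z => by linarith [hφ z, hB z, norm_le_norm_add_norm_sub' (φ z) (F z)]
  have h₂ : ε / (4 * M + 1) * (4 * M + 1) = ε := div_mul_cancel₀ _ (by positivity)
  linarith [norm_le_norm_add_norm_sub (E.simpleIntegral φ) T]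

theorem HasBoundedIntegral.unique [CompleteSpace X] {F : ℂ → ℂ} {T S : X →L[ℂ] X}
    (hT : E.HasBoundedIntegral F T) (hS : E.HasBoundedIntegral F S) : T = S := by
  obtain ⟨C, -, hC⟩ := E.exists_norm_le_of_hasBoundedIntegral
  have := hC _ _ 0 le_rfl (hT.sub hS) (by simp)
  rw [mul_zero] at this
  exact sub_eq_zero.1 (norm_le_zero_iff.1 this)

/-- Round `F` to the nearest point of a finite `ε`-net of the compact disc containing its values. -/
theorem exists_simpleFunc_near {F : ℂ → ℂ} (hF : Measurable F) {R : ℝ} (hR : ∀ z, ‖F z‖ ≤ R)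
    {ε : ℝ} (hε : 0 < ε) : ∃ φ : SimpleFunc ℂ ℂ, ∀ z, ‖φ z - F z‖ < ε := by
  let e := TopologicalSpace.denseSeq ℂ
  obtain ⟨t, ht⟩ := (isCompact_closedBall (0 : ℂ) R).elim_finite_subcover
    (fun n => Metric.ball (e n) ε) (fun _ => Metric.isOpen_ball) fun z _ => by
      obtain ⟨n, hn⟩ := (TopologicalSpace.denseRange_denseSeq ℂ).exists_dist_lt z hε
      exact mem_iUnion.2 ⟨n, hn⟩
  refine ⟨(SimpleFunc.nearestPt e (t.sup id)).comp F hF, fun z => ?_⟩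
  have hz := ht (show F z ∈ Metric.closedBall 0 R by simpa using hR z)
  simp only [mem_iUnion] at hz
  obtain ⟨n, hn, hnz⟩ := hz
  rw [SimpleFunc.coe_comp, Function.comp_apply, ← dist_eq_norm]
  refine lt_of_le_of_lt ?_ (Metric.mem_ball'.1 hnz)
  have := SimpleFunc.edist_nearestPt_le e (F z) (Finset.le_sup (f := id) hn)
  rwa [edist_dist, edist_dist, ENNReal.ofReal_le_ofReal_iff dist_nonneg] at this

theorem exists_hasBoundedIntegral [CompleteSpace X] {F : ℂ → ℂ} (hF : Measurable F) {R : ℝ}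
    (hR : ∀ z, ‖F z‖ ≤ R) : ∃ T, E.HasBoundedIntegral F T := by
  choose φ hφ using fun n : ℕ =>
    exists_simpleFunc_near hF hR (ε := 1 / ((n : ℝ) + 1)) Nat.one_div_pos_of_nat
  have hlim : TendstoUniformly (fun n z => φ n z) F atTop :=
    Metric.tendstoUniformly_iff.2 fun ε hε => by
      filter_upwards [tendsto_one_div_add_atTop_nhds_zero_nat.eventually_lt_const hε] with n hn z
      rw [dist_comm, dist_eq_norm]
      exact (hφ n z).trans hn
  obtain ⟨M, hM0, hM⟩ := E.exists_norm_proj_le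
  have hcauchy : CauchySeq fun n => E.simpleIntegral (φ n) := by
    refine Metric.cauchySeq_iff'.2 fun ε hε => ?_
    have hδ : 0 < ε / (4 * M + 1) / 2 := by positivity
    obtain ⟨N, hN⟩ := eventually_atTop.1 (Metric.tendstoUniformly_iff.1 hlim _ hδ)
    refine ⟨N, fun n hn => ?_⟩
    rw [dist_eq_norm, ← simpleIntegral_sub]
    refine (E.norm_simpleIntegral_le hM0 hM _ (B := ε / (4 * M + 1)) (by positivity)
      fun z => ?_).trans_lt ?_
    · rw [SimpleFunc.coe_sub, Pi.sub_apply, ← dist_eq_norm]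
      linarith [dist_triangle_left (φ n z) (φ N z) (F z), hN n hn z, hN N le_rfl z]
    · rw [mul_div_assoc', div_lt_iff₀ (by positivity)]
      linarith
  obtain ⟨T, hT⟩ := cauchySeq_tendsto_of_complete hcauchy
  exact ⟨T, φ, hlim, hT⟩

end SpectralMeasure

/-! ### Graphs of powers, bounded linear equations and weak derivatives. -/

theorem mem_graph_opPow_zero {A : X →ₗ.[ℂ] X} {x v : X} :
    (x, v) ∈ (opPow A 0).graph ↔ x = v := by
  simp [LinearPMap.mem_graph_iff, opPow]

theorem mem_graph_opMul {A B : X →ₗ.[ℂ] X} {x v : X} :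
    (x, v) ∈ (opMul B A).graph ↔ ∃ w, (x, w) ∈ A.graph ∧ (w, v) ∈ B.graph := by
  simp only [LinearPMap.mem_graph_iff]
  constructor
  · rintro ⟨⟨_, z, hz, rfl⟩, rfl, rfl⟩
    exact ⟨A z, ⟨z, rfl, rfl⟩, ⟨A z, hz⟩, rfl, rfl⟩
  · rintro ⟨_, ⟨z, rfl, rfl⟩, ⟨w, hw, rfl⟩⟩
    exact ⟨⟨z, z, show A z ∈ B.domain from hw ▸ w.2, rfl⟩, rfl, by
      change B ⟨A z, _⟩ = B w
      congr 1
      exact Subtype.ext hw.symm⟩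

theorem mem_graph_opPow_succ {A : X →ₗ.[ℂ] X} {n : ℕ} {x v : X} :
    (x, v) ∈ (opPow A (n + 1)).graph ↔ ∃ w, (x, w) ∈ (opPow A n).graph ∧ (w, v) ∈ A.graph :=
  mem_graph_opMul

/-- The function `r ↦ exp ((t - r) T) (u r)` has zero derivative; compare its values at `s` and `t`.
-/
theorem eq_exp_smul_of_hasDerivWithinAt [CompleteSpace X] {T : X →L[ℂ] X} {u : ℝ → X}
    (hu : ∀ t ∈ Ici (0 : ℝ), HasDerivWithinAt u (T (u t)) (Ici 0) t) {s t : ℝ} (hs : 0 ≤ s)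
    (ht : 0 ≤ t) : u t = NormedSpace.exp (((t - s : ℝ) : ℂ) • T) (u s) := by
  have hexp (r : ℝ) : HasDerivAt (fun r : ℝ => NormedSpace.exp (((t - r : ℝ) : ℂ) • T))
      (-(NormedSpace.exp (((t - r : ℝ) : ℂ) • T) * T)) r := by
    have h₁ : HasDerivAt (fun r : ℝ => ((t - r : ℝ) : ℂ)) (-1) r := by
      simpa using ((hasDerivAt_id r).const_sub t).ofReal_comp
    simpa using! (hasDerivAt_exp_smul_const T ((t - r : ℝ) : ℂ)).scomp r h₁
  have hderiv : ∀ r ∈ Ici (0 : ℝ),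
      HasDerivWithinAt (fun r : ℝ => NormedSpace.exp (((t - r : ℝ) : ℂ) • T) (u r)) 0 (Ici 0) r := by
    intro r hr
    have h := (((isBoundedBilinearMap_apply (𝕜 := ℂ) (E := X) (F := X)).hasFDerivAt
      (NormedSpace.exp (((t - r : ℝ) : ℂ) • T), u r)).restrictScalars ℝ).comp_hasDerivWithinAt r
        ((hexp r).hasDerivWithinAt.prodMk (hu r hr))
    simpa using! h
  have h := (convex_Ici (0 : ℝ)).norm_image_sub_le_of_norm_hasDerivWithin_le hderiv
    (C := 0) (by simp) (x := s) (y := t) hs ht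
  rw [zero_mul] at h
  simpa [NormedSpace.exp_zero] using sub_eq_zero.1 (norm_le_zero_iff.1 h)

/-- A weak derivative that is norm continuous is a norm derivative: apply the mean value inequality
to a functional norming the remainder. The radius `δ` comes from the continuity of `w`, so it does
not depend on the functional. -/
theorem hasDerivWithinAt_of_dual {u w : ℝ → X} {s : Set ℝ} (hs : Convex ℝ s)
    (hw : ContinuousOn w s)
    (h : ∀ g : StrongDual ℂ X, ∀ t ∈ s, HasDerivWithinAt (fun r => g (u r)) (g (w t)) s t)
    {t : ℝ} (ht : t ∈ s) : HasDerivWithinAt u (w t) s t := by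
  rw [hasDerivWithinAt_iff_isLittleO, Asymptotics.isLittleO_iff]
  intro ε hε
  obtain ⟨δ, hδ, hwδ⟩ := Metric.continuousWithinAt_iff.1 (hw t ht) ε hε
  filter_upwards [inter_mem_nhdsWithin s (Metric.ball_mem_nhds t hδ)] with r hr
  obtain ⟨g, hg, hgv⟩ := exists_dual_vector'' ℂ (u r - u t - (r - t) • w t)
  have hconv : Convex ℝ (s ∩ Metric.ball t δ) := hs.inter (convex_ball t δ)
  have hmv := hconv.norm_image_sub_le_of_norm_hasDerivWithin_le
    (f := fun q => g (u q) - (q - t) • g (w t)) (f' := fun q => g (w q) - g (w t)) (C := ε)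
    (x := t) (y := r) (fun q hq => by
      have h₁ : HasDerivWithinAt (fun q : ℝ => (q - t) • g (w t)) (g (w t)) (s ∩ Metric.ball t δ) q := by
        simpa using (((hasDerivAt_id q).sub_const t).smul_const (g (w t))).hasDerivWithinAt
      exact ((h g q hq.1).mono inter_subset_left).sub h₁)
    (fun q hq => by
      have := hwδ hq.1 hq.2
      rw [dist_eq_norm] at this
      rw [← map_sub]
      exact (g.le_of_opNorm_le hg _).trans (by linarith)) ⟨ht, Metric.mem_ball_self hδ⟩ hr
  calc ‖u r - u t - (r - t) • w t‖ = ‖g (u r - u t - (r - t) • w t)‖ := by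
        rw [hgv]; simp
    _ = ‖g (u r) - (r - t) • g (w t) - (g (u t) - (t - t) • g (w t))‖ := by
        rw [map_sub, map_sub, g.map_smul_of_tower]
        congr 1
        simp only [sub_self, zero_smul]
        change g (u r) - g (u t) - (r - t) • g (w t) = _
        abel
    _ ≤ ε * ‖r - t‖ := hmv

/-! ### Truncation to discs and the two-endpoint estimate. -/

namespace SpectralMeasure

variable (E : SpectralMeasure X)

/-- The spectral projection of the closed disc of radius `k`. -/
noncomputable def truncProj (k : ℕ) : X →L[ℂ] X := E.proj {z | ‖z‖ ≤ k}

theorem measurableSet_norm_le (k : ℕ) : MeasurableSet {z : ℂ | ‖z‖ ≤ k} :=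
  measurableSet_le measurable_norm measurable_const

theorem exists_truncOp [CompleteSpace X] (k : ℕ) :
    ∃ T, E.HasBoundedIntegral ({z | ‖z‖ ≤ k}.indicator fun z => z) T :=
  exists_hasBoundedIntegral (measurable_id.indicator (measurableSet_norm_le k)) (R := k) fun z => by
    by_cases hz : ‖z‖ ≤ k <;> simp [indicator, hz]

/-- The bounded operator `∫ z dE(z)` over the closed disc of radius `k`. -/
noncomputable def truncOp [CompleteSpace X] (k : ℕ) : X →L[ℂ] X := (E.exists_truncOp k).choose

theorem hasBoundedIntegral_truncOp [CompleteSpace X] (k : ℕ) :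
    E.HasBoundedIntegral ({z | ‖z‖ ≤ k}.indicator fun z => z) (E.truncOp k) :=
  (E.exists_truncOp k).choose_spec

theorem hasBoundedIntegral_truncProj (k : ℕ) :
    E.HasBoundedIntegral ({z | ‖z‖ ≤ k}.indicator fun _ => 1) (E.truncProj k) :=
  hasBoundedIntegral_indicator (measurableSet_norm_le k)

theorem truncProj_mul_truncOp [CompleteSpace X] {k n : ℕ} (h : k ≤ n) :
    E.truncProj k * E.truncOp n = E.truncOp k := by
  refine ((E.hasBoundedIntegral_truncProj k).mul (E.hasBoundedIntegral_truncOp n)).unique ?_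
  convert E.hasBoundedIntegral_truncOp k using 1
  ext z
  by_cases hz : ‖z‖ ≤ k
  · have : ‖z‖ ≤ n := hz.trans (by exact_mod_cast h)
    simp [indicator, hz, this]
  · simp [indicator, hz]

theorem truncOp_mul_truncProj [CompleteSpace X] {k n : ℕ} (h : k ≤ n) :
    E.truncOp n * E.truncProj k = E.truncOp k := by
  rw [← E.truncProj_mul_truncOp h]
  refine ((E.hasBoundedIntegral_truncOp n).mul (E.hasBoundedIntegral_truncProj k)).unique ?_
  rw [mul_comm]
  exact (E.hasBoundedIntegral_truncProj k).mul (E.hasBoundedIntegral_truncOp n)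

theorem truncOp_truncProj [CompleteSpace X] (k : ℕ) (x : X) :
    E.truncOp k (E.truncProj k x) = E.truncOp k x :=
  congr($(E.truncOp_mul_truncProj le_rfl) x)

theorem tendsto_truncProj (x : X) : Tendsto (fun k => E.truncProj k x) atTop (𝓝 x) := by
  have h := VectorMeasure.tendsto_vectorMeasure_iUnion_atTop_nat (v := E.vectorMeasure x)
    (s := fun k : ℕ => {z : ℂ | ‖z‖ ≤ k})
    (fun i j hij z (hz : ‖z‖ ≤ i) => show ‖z‖ ≤ j from hz.trans (by exact_mod_cast hij))
    (fun k => measurableSet_norm_le k)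
  have hU : (⋃ k : ℕ, {z : ℂ | ‖z‖ ≤ k}) = Set.univ :=
    eq_univ_of_forall fun z => mem_iUnion.2 (exists_nat_ge ‖z‖)
  rw [hU, E.vectorMeasure_apply x .univ, E.univ] at h
  refine h.congr fun k => ?_
  exact E.vectorMeasure_apply x (measurableSet_norm_le k)

theorem norm_le_of_norm_truncProj_le {v : X} {B : ℝ} (h : ∀ k, ‖E.truncProj k v‖ ≤ B) : ‖v‖ ≤ B :=
  le_of_tendsto' (E.tendsto_truncProj v).norm h

theorem hasIntegralAt_id_iff [CompleteSpace X] {x v : X} :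
    E.HasIntegralAt (fun z => z) x v ↔ Tendsto (fun k => E.truncOp k x) atTop (𝓝 v) := by
  constructor
  · rintro ⟨T, hT, h⟩
    simpa only [(hT _).unique (E.hasBoundedIntegral_truncOp _)] using h
  · exact fun h => ⟨E.truncOp, E.hasBoundedIntegral_truncOp, h⟩

/-- Solutions of `u' = T u`, for `T` the integral of `z` over any disc, are bounded between two
points by their values there: on the spectral subspace `Re z ≤ 0` they decrease, and on
`Re z > 0` they increase. -/
theorem exists_norm_le_of_hasDerivWithinAt_truncOp [CompleteSpace X] :
    ∃ C, 0 < C ∧ ∀ (k : ℕ) (u : ℝ → X),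
      (∀ t ∈ Ici (0 : ℝ), HasDerivWithinAt u (E.truncOp k (u t)) (Ici 0) t) →
      ∀ a t b : ℝ, 0 ≤ a → a ≤ t → t ≤ b → ‖u t‖ ≤ C * (‖u a‖ + ‖u b‖) := by
  obtain ⟨C, hC0, hC⟩ := E.exists_norm_le_of_hasBoundedIntegral
  refine ⟨C + 1, by positivity, fun k u hu a t b ha hat htb => ?_⟩
  have hP : MeasurableSet {z : ℂ | z.re ≤ 0} := measurableSet_le Complex.measurable_re measurable_const
  -- The operator is the integral of a function of modulus at most `1`: it vanishes off `S`, and off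
  -- the disc the exponent is `0`.
  have key (S : Set ℂ) (hS : MeasurableSet S) (r : ℝ) (h : ∀ z ∈ S, r * z.re ≤ 0) :
      ‖E.proj S * NormedSpace.exp ((r : ℂ) • E.truncOp k)‖ ≤ C := by
    rw [← mul_one C]
    refine hC _ _ 1 zero_le_one ((hasBoundedIntegral_indicator hS).mul
      ((E.hasBoundedIntegral_truncOp k).smul r).exp) fun z => ?_
    by_cases hz : z ∈ S
    · by_cases hk : ‖z‖ ≤ k
      · simpa [hz, hk, Complex.norm_exp, indicator] using h z hz
      · simp [hz, hk, indicator]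
    · simp [hz]
  have h₁ := key _ hP (t - a) fun z hz => mul_nonpos_of_nonneg_of_nonpos (by linarith) hz
  have h₂ := key _ hP.compl (t - b) fun z hz =>
    mul_nonpos_of_nonpos_of_nonneg (by linarith) (not_le.1 (show ¬ z.re ≤ 0 from hz)).le
  have hsum : u t = E.proj {z | z.re ≤ 0} (u t) + E.proj {z | z.re ≤ 0}ᶜ (u t) := by
    have h := (E.vectorMeasure (u t)).of_union (A := {z | z.re ≤ 0}) disjoint_compl_right hP hP.compl
    rw [union_compl_self] at h
    rw [E.vectorMeasure_apply _ .univ, E.vectorMeasure_apply _ hP,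
      E.vectorMeasure_apply _ hP.compl, E.univ] at h
    exact h
  have ht : 0 ≤ t := ha.trans hat
  calc ‖u t‖ ≤ ‖E.proj {z | z.re ≤ 0} (u t)‖ + ‖E.proj {z | z.re ≤ 0}ᶜ (u t)‖ := by
        conv_lhs => rw [hsum]
        exact norm_add_le _ _
    _ ≤ C * ‖u a‖ + C * ‖u b‖ := by
        refine add_le_add ?_ ?_
        · rw [eq_exp_smul_of_hasDerivWithinAt hu ha ht]
          exact ContinuousLinearMap.le_of_opNorm_le _ h₁ (u a)
        · rw [eq_exp_smul_of_hasDerivWithinAt hu (ht.trans htb) ht]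
          exact ContinuousLinearMap.le_of_opNorm_le _ h₂ (u b)
    _ ≤ (C + 1) * (‖u a‖ + ‖u b‖) := by nlinarith [norm_nonneg (u a), norm_nonneg (u b)]

end SpectralMeasure

/-! ### The operator and its weak solutions, seen through truncations. -/

namespace IsSpectralMeasureOf

variable [CompleteSpace X] {A : X →ₗ.[ℂ] X} {E : SpectralMeasure X}

theorem mem_graph_iff_tendsto (hA : IsSpectralMeasureOf E A) {x v : X} :
    (x, v) ∈ A.graph ↔ Tendsto (fun k => E.truncOp k x) atTop (𝓝 v) := by
  rw [hA.mem_graph_iff, E.hasIntegralAt_id_iff]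

/-- Apply `P k` to `T n x → v`; the sequence is constantly `T k x` once `n ≥ k`. -/
theorem truncProj_of_mem_graph (hA : IsSpectralMeasureOf E A) {x v : X} (h : (x, v) ∈ A.graph) (k : ℕ) :
    E.truncProj k v = E.truncOp k x := by
  have h₁ := ((E.truncProj k).continuous.tendsto v).comp (hA.mem_graph_iff_tendsto.1 h)
  refine tendsto_nhds_unique h₁ (tendsto_const_nhds.congr' ?_)
  filter_upwards [eventually_ge_atTop k] with n hn
  exact congr($((E.truncProj_mul_truncOp hn).symm) x)

theorem mem_graph_of_truncOp_eq (hA : IsSpectralMeasureOf E A)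
    {x v : X} (h : ∀ k, E.truncOp k x = E.truncProj k v) :
    (x, v) ∈ A.graph := by
  rw [hA.mem_graph_iff_tendsto]
  simpa only [h] using E.tendsto_truncProj v

theorem truncProj_of_mem_graph_opPow (hA : IsSpectralMeasureOf E A)
    {n : ℕ} {x v : X} (h : (x, v) ∈ (opPow A n).graph) (k : ℕ) :
    E.truncProj k v = (E.truncOp k ^ n) (E.truncProj k x) := by
  induction n generalizing v with
  | zero => rw [mem_graph_opPow_zero.1 h]; rfl
  | succ n ih =>
    obtain ⟨w, hw, hwv⟩ := mem_graph_opPow_succ.1 h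
    rw [hA.truncProj_of_mem_graph hwv, ← E.truncOp_truncProj, ih hw, pow_succ']
    rfl

/-- For every functional `g`, `g ∘ P k` lies in the domain of the adjoint, with image `g ∘ T k`. So
`P k y` has the weak derivative `T k y`, which is norm continuous. -/
theorem hasDerivWithinAt_truncProj (hA : IsSpectralMeasureOf E A)
    {y : ℝ → X} (hy : IsWeakSolution A y) (k : ℕ) {t : ℝ}
    (ht : t ∈ Ici (0 : ℝ)) :
    HasDerivWithinAt (fun s => E.truncProj k (y s)) (E.truncOp k (y t)) (Ici 0) t := by
  refine hasDerivWithinAt_of_dual (w := fun s => E.truncOp k (y s)) (convex_Ici 0)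
    ((E.truncOp k).continuous.comp_continuousOn hy.1) (fun g r hr => ?_) ht
  refine hy.2 (g.comp (E.truncProj k)) (g.comp (E.truncOp k)) (fun x => ?_) r hr
  exact congrArg g (hA.truncProj_of_mem_graph (A.mem_graph x) k)

theorem hasDerivWithinAt_truncOp_pow (hA : IsSpectralMeasureOf E A)
    {y : ℝ → X} (hy : IsWeakSolution A y) (k n : ℕ) {t : ℝ}
    (ht : t ∈ Ici (0 : ℝ)) :
    HasDerivWithinAt (fun s => (E.truncOp k ^ n) (E.truncProj k (y s)))
      ((E.truncOp k ^ (n + 1)) (E.truncProj k (y t))) (Ici 0) t := by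
  have h := (((E.truncOp k ^ n).hasFDerivAt (x := E.truncProj k (y t))).restrictScalars
    ℝ).comp_hasDerivWithinAt t (hA.hasDerivWithinAt_truncProj hy k ht)
  rw [← E.truncOp_truncProj] at h
  simpa [pow_succ] using! h

end IsSpectralMeasureOf

end Gevrey

/-! ### One-variable calculus on intervals. -/

namespace Gevrey

theorem uniqueDiffOn_of_ordConnected {I : Set ℝ} (hI : I.OrdConnected) (hI' : I.Nontrivial) :
    UniqueDiffOn ℝ I := by
  obtain ⟨a, ha, b, hb, hab⟩ := hI'.exists_lt
  refine uniqueDiffOn_convex hI.convex ?_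
  rw [← nonempty_Ioo] at hab
  exact hab.mono (interior_maximal (Ioo_subset_Icc_self.trans (hI.out ha hb)) isOpen_Ioo)

theorem exists_Icc_mem_nhdsWithin {I : Set ℝ} {t : ℝ} (ht : t ∈ I) :
    ∃ a ∈ I, ∃ b ∈ I, t ∈ Icc a b ∧ Icc a b ∈ 𝓝[I] t := by
  have left : ∃ a ∈ I, a ≤ t ∧ ∀ᶠ s in 𝓝[I] t, a ≤ s := by
    by_cases h : ∃ a ∈ I, a < t
    · obtain ⟨a, ha, hat⟩ := h
      exact ⟨a, ha, hat.le, nhdsWithin_le_nhds (Ici_mem_nhds hat)⟩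
    · push Not at h
      exact ⟨t, ht, le_rfl, eventually_nhdsWithin_of_forall h⟩
  have right : ∃ b ∈ I, t ≤ b ∧ ∀ᶠ s in 𝓝[I] t, s ≤ b := by
    by_cases h : ∃ b ∈ I, t < b
    · obtain ⟨b, hb, hbt⟩ := h
      exact ⟨b, hb, hbt.le, nhdsWithin_le_nhds (Iic_mem_nhds hbt)⟩
    · push Not at h
      exact ⟨t, ht, le_rfl, eventually_nhdsWithin_of_forall h⟩
  obtain ⟨a, ha, hat, ha'⟩ := left
  obtain ⟨b, hb, htb, hb'⟩ := right
  exact ⟨a, ha, b, hb, ⟨hat, htb⟩, ha'.and hb'⟩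

section Calculus

variable {X : Type*} [NormedAddCommGroup X] [NormedSpace ℝ X]

/-- Two applications of the mean value inequality. The bound involves only `B`, so it survives
limits of functions with a common bound on second derivatives. -/
theorem norm_sub_sub_smul_le_of_hasDerivWithinAt {u u' u'' : ℝ → X} {s : Set ℝ}
    (hs : Convex ℝ s) (h₀ : ∀ t ∈ s, HasDerivWithinAt u (u' t) s t)
    (h₁ : ∀ t ∈ s, HasDerivWithinAt u' (u'' t) s t) {B : ℝ} (hB : ∀ t ∈ s, ‖u'' t‖ ≤ B)
    {t r : ℝ} (ht : t ∈ s) (hr : r ∈ s) :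
    ‖u r - u t - (r - t) • u' t‖ ≤ B * ‖r - t‖ * ‖r - t‖ := by
  have hB0 : 0 ≤ B := (norm_nonneg _).trans (hB t ht)
  have hsub : uIcc t r ⊆ s := (convex_iff_ordConnected.1 hs).uIcc_subset ht hr
  have h := (convex_uIcc t r).norm_image_sub_le_of_norm_hasDerivWithin_le
    (f := fun q => u q - (q - t) • u' t) (f' := fun q => u' q - u' t) (C := B * ‖r - t‖)
    (x := t) (y := r) (fun q hq => by
      have h₂ : HasDerivWithinAt (fun q : ℝ => (q - t) • u' t) (u' t) (uIcc t r) q := by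
        simpa using (((hasDerivAt_id q).sub_const t).smul_const (u' t)).hasDerivWithinAt
      exact ((h₀ q (hsub hq)).mono hsub).sub h₂)
    (fun q hq => by
      refine (hs.norm_image_sub_le_of_norm_hasDerivWithin_le h₁ hB ht (hsub hq)).trans ?_
      exact mul_le_mul_of_nonneg_left (abs_sub_left_of_mem_uIcc hq) hB0) left_mem_uIcc right_mem_uIcc
  convert h using 2
  simp only [sub_self, zero_smul, sub_zero]
  abel

theorem hasDerivWithinAt_of_norm_sub_sub_smul_le {u : ℝ → X} {u' : X} {s : Set ℝ} {t B : ℝ}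
    (h : ∀ᶠ r in 𝓝[s] t, ‖u r - u t - (r - t) • u'‖ ≤ B * ‖r - t‖ * ‖r - t‖) :
    HasDerivWithinAt u u' s t := by
  rw [hasDerivWithinAt_iff_isLittleO, Asymptotics.isLittleO_iff]
  intro ε hε
  have hlim : Tendsto (fun r => B * ‖r - t‖) (𝓝[s] t) (𝓝 0) := by
    have : Continuous fun r => B * ‖r - t‖ := by fun_prop
    simpa using (this.tendsto t).mono_left nhdsWithin_le_nhds
  filter_upwards [h, hlim.eventually_le_const hε] with r h₁ h₂
  exact h₁.trans (by gcongr)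

theorem iteratedDerivWithin_eq_of_hasDerivWithinAt {v : ℕ → ℝ → X} {s : Set ℝ}
    (hs : UniqueDiffOn ℝ s) (h : ∀ n, ∀ t ∈ s, HasDerivWithinAt (v n) (v (n + 1) t) s t) (n : ℕ) :
    EqOn (iteratedDerivWithin n (v 0) s) (v n) s := by
  induction n with
  | zero => intro t _; rw [iteratedDerivWithin_zero]
  | succ n ih =>
    intro t ht
    rw [iteratedDerivWithin_succ, derivWithin_congr ih (ih ht)]
    exact (h n t ht).derivWithin (hs t ht)

theorem contDiffOn_of_hasDerivWithinAt {v : ℕ → ℝ → X} {s : Set ℝ}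
    (hs : UniqueDiffOn ℝ s) (h : ∀ n, ∀ t ∈ s, HasDerivWithinAt (v n) (v (n + 1) t) s t) :
    ContDiffOn ℝ ∞ (v 0) s :=
  contDiffOn_of_differentiableOn_deriv fun n _ => DifferentiableOn.congr
    (fun t ht => (h n t ht).differentiableWithinAt) (iteratedDerivWithin_eq_of_hasDerivWithinAt hs h n)

theorem _root_.ContDiffOn.hasDerivWithinAt_iteratedDerivWithin {y : ℝ → X} {s : Set ℝ}
    (hy : ContDiffOn ℝ ∞ y s) (hs : UniqueDiffOn ℝ s) (n : ℕ) {t : ℝ} (ht : t ∈ s) :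
    HasDerivWithinAt (iteratedDerivWithin n y s) (iteratedDerivWithin (n + 1) y s t) s t := by
  rw [iteratedDerivWithin_succ]
  exact (hy.differentiableOn_iteratedDerivWithin (by exact_mod_cast ENat.natCast_lt_top n) hs t
    ht).hasDerivWithinAt

end Calculus

/-! ### Smoothness of weak solutions and domains of powers. -/

variable {X : Type*} [NormedAddCommGroup X] [NormedSpace ℂ X]

theorem exists_apply_eq_of_mem_graph {f : X →ₗ.[ℂ] X} {x v : X} (h : (x, v) ∈ f.graph) :
    ∃ hx : x ∈ f.domain, f ⟨x, hx⟩ = v := by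
  obtain ⟨z, hz, hv⟩ := f.mem_graph_iff.1 h
  dsimp only at hz hv
  subst hz
  exact ⟨z.2, hv⟩

theorem mem_gevreyRoumieuVec_iff {A : X →ₗ.[ℂ] X} {β : ℝ} {x : X} {v : ℕ → X}
    (h : ∀ n, (x, v n) ∈ (opPow A n).graph) :
    x ∈ gevreyRoumieuVec β A ↔ ∃ α > (0 : ℝ), ∃ c > (0 : ℝ),
      ∀ n : ℕ, ‖v n‖ ≤ c * α ^ n * (n.factorial : ℝ) ^ β := by
  choose hx hv using fun n => exists_apply_eq_of_mem_graph (h n)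
  simp only [gevreyRoumieuVec, mem_ofPred_eq, hv]
  exact exists_prop_of_true hx

theorem mem_gevreyBeurlingVec_iff {A : X →ₗ.[ℂ] X} {β : ℝ} {x : X} {v : ℕ → X}
    (h : ∀ n, (x, v n) ∈ (opPow A n).graph) :
    x ∈ gevreyBeurlingVec β A ↔ ∀ α > (0 : ℝ), ∃ c > (0 : ℝ),
      ∀ n : ℕ, ‖v n‖ ≤ c * α ^ n * (n.factorial : ℝ) ^ β := by
  choose hx hv using fun n => exists_apply_eq_of_mem_graph (h n)
  simp only [gevreyBeurlingVec, mem_ofPred_eq, hv]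
  exact exists_prop_of_true hx

namespace IsSpectralMeasureOf

variable [CompleteSpace X] {A : X →ₗ.[ℂ] X} {E : SpectralMeasure X} {y : ℝ → X} {I : Set ℝ}

theorem mem_graph_opPow_iteratedDerivWithin (hA : IsSpectralMeasureOf E A)
    (hy : IsWeakSolution A y) (hI : UniqueDiffOn ℝ I)
    (hI_sub : I ⊆ Ici 0) (hsmooth : ContDiffOn ℝ ∞ y I) (n : ℕ) {t : ℝ} (ht : t ∈ I) :
    (y t, iteratedDerivWithin n y I t) ∈ (opPow A n).graph := by
  -- Both sides at order `n + 1` are derivatives of the equal functions at order `n`, and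
  -- derivatives within `I` are unique.
  have key (k n : ℕ) : ∀ t ∈ I, E.truncProj k (iteratedDerivWithin n y I t) =
      (E.truncOp k ^ n) (E.truncProj k (y t)) := by
    induction n with
    | zero => intro t _; rw [iteratedDerivWithin_zero]; rfl
    | succ n ih =>
      intro t ht
      have h₁ := ((E.truncProj k).hasFDerivAt.restrictScalars ℝ).comp_hasDerivWithinAt t
        (hsmooth.hasDerivWithinAt_iteratedDerivWithin hI n ht)
      have h₂ := ((hA.hasDerivWithinAt_truncOp_pow hy k n (hI_sub ht)).mono hI_sub).congr ih (ih t ht)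
      exact (hI t ht).eq_deriv _ h₁ h₂
  induction n with
  | zero => exact mem_graph_opPow_zero.2 (by rw [iteratedDerivWithin_zero])
  | succ n ih =>
    refine mem_graph_opPow_succ.2 ⟨_, ih, hA.mem_graph_of_truncOp_eq fun k => ?_⟩
    rw [key k (n + 1) t ht, ← E.truncOp_truncProj, key k n t ht, pow_succ']
    rfl

/-- No continuity of `t ↦ A^n y(t)` is given. The two-endpoint estimate bounds `P k A^(n+2) y` on
`[a, b]` uniformly in `k`, which bounds the Taylor remainder of `P k A^n y`; then `k → ∞`. -/
theorem contDiffOn_of_mem_domain_opPow (hA : IsSpectralMeasureOf E A)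
    (hy : IsWeakSolution A y) (hI : I.OrdConnected)
    (hI_nontrivial : I.Nontrivial) (hI_sub : I ⊆ Ici 0)
    (hdom : ∀ n, ∀ t ∈ I, y t ∈ (opPow A n).domain) : ContDiffOn ℝ ∞ y I := by
  classical
  have hex (n : ℕ) (t : ℝ) : ∃ w, t ∈ I → (y t, w) ∈ (opPow A n).graph := by
    by_cases ht : t ∈ I
    · exact ⟨opPow A n ⟨y t, hdom n t ht⟩, fun _ => (opPow A n).mem_graph ⟨y t, hdom n t ht⟩⟩
    · exact ⟨0, fun h => absurd h ht⟩
  choose v hv using hex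
  obtain ⟨C, hC0, hC⟩ := E.exists_norm_le_of_hasDerivWithinAt_truncOp
  obtain ⟨M, hM0, hM⟩ := E.exists_norm_proj_le
  have hEv (k n : ℕ) : ∀ t ∈ I, E.truncProj k (v n t) = (E.truncOp k ^ n) (E.truncProj k (y t)) :=
    fun t ht => hA.truncProj_of_mem_graph_opPow (hv n t ht) k
  have hderiv (k n : ℕ) : ∀ t ∈ I,
      HasDerivWithinAt (fun s => E.truncProj k (v n s)) (E.truncProj k (v (n + 1) t)) I t := by
    intro t ht
    rw [hEv k (n + 1) t ht]
    exact ((hA.hasDerivWithinAt_truncOp_pow hy k n (hI_sub ht)).mono hI_sub).congr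
      (hEv k n) (hEv k n t ht)
  have hbound (k n : ℕ) {a t b : ℝ} (ha : a ∈ I) (hb : b ∈ I) (ht : t ∈ Icc a b) :
      ‖E.truncProj k (v n t)‖ ≤ C * (‖E.truncProj k (v n a)‖ + ‖E.truncProj k (v n b)‖) := by
    rw [hEv k n a ha, hEv k n b hb, hEv k n t (hI.out ha hb ht)]
    refine hC k (fun s => (E.truncOp k ^ n) (E.truncProj k (y s))) (fun s hs => ?_) a t b
      (hI_sub ha) ht.1 ht.2
    have := hA.hasDerivWithinAt_truncOp_pow hy k n hs
    rwa [pow_succ'] at this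
  have hnorm (k : ℕ) (x : X) : ‖E.truncProj k x‖ ≤ M * ‖x‖ :=
    (E.truncProj k).le_of_opNorm_le (hM _ (SpectralMeasure.measurableSet_norm_le k)) x
  have hv' : ∀ n, ∀ t ∈ I, HasDerivWithinAt (v n) (v (n + 1) t) I t := by
    intro n t ht
    obtain ⟨a, ha, b, hb, htab, hnhds⟩ := exists_Icc_mem_nhdsWithin ht
    have hsub := hI.out ha hb
    refine hasDerivWithinAt_of_norm_sub_sub_smul_le
      (B := C * (M * ‖v (n + 2) a‖ + M * ‖v (n + 2) b‖)) ?_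
    filter_upwards [hnhds] with r hr
    refine E.norm_le_of_norm_truncProj_le fun k => ?_
    have h := norm_sub_sub_smul_le_of_hasDerivWithinAt (convex_Icc a b)
      (fun q hq => (hderiv k n q (hsub hq)).mono hsub)
      (fun q hq => (hderiv k (n + 1) q (hsub hq)).mono hsub)
      (B := C * (M * ‖v (n + 2) a‖ + M * ‖v (n + 2) b‖)) (fun q hq =>
        (hbound k (n + 2) ha hb hq).trans (by gcongr <;> exact hnorm k _)) htab hr
    rwa [map_sub, map_sub, (E.truncProj k).map_smul_of_tower]
  have hv0 : EqOn y (v 0) I := fun t ht => mem_graph_opPow_zero.1 (hv 0 t ht)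
  exact (contDiffOn_of_hasDerivWithinAt (uniqueDiffOn_of_ordConnected hI hI_nontrivial) hv').congr hv0

/-- The constant precedes `n`, so the growth rate in `n` on `[a, b]` is dictated by the endpoints.
-/
theorem exists_norm_iteratedDerivWithin_le (hA : IsSpectralMeasureOf E A)
    (hy : IsWeakSolution A y) (hI : I.OrdConnected)
    (hI_nontrivial : I.Nontrivial) (hI_sub : I ⊆ Ici 0) (hsmooth : ContDiffOn ℝ ∞ y I) :
    ∃ C, 0 < C ∧ ∀ n : ℕ, ∀ a ∈ I, ∀ b ∈ I, ∀ t ∈ Icc a b,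
      ‖iteratedDerivWithin n y I t‖ ≤
        C * (‖iteratedDerivWithin n y I a‖ + ‖iteratedDerivWithin n y I b‖) := by
  obtain ⟨C, hC0, hC⟩ := E.exists_norm_le_of_hasDerivWithinAt_truncOp
  refine ⟨C, hC0, fun n a ha b hb t ht => ?_⟩
  have hE (k : ℕ) : ∀ s ∈ I, E.truncProj k (iteratedDerivWithin n y I s) =
      (E.truncOp k ^ n) (E.truncProj k (y s)) := fun s hs =>
    hA.truncProj_of_mem_graph_opPow (hA.mem_graph_opPow_iteratedDerivWithin hy
      (uniqueDiffOn_of_ordConnected hI hI_nontrivial) hI_sub hsmooth n hs) k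
  refine le_of_tendsto_of_tendsto' (E.tendsto_truncProj _).norm
    (((E.tendsto_truncProj _).norm.add (E.tendsto_truncProj _).norm).const_mul C) fun k => ?_
  rw [hE k a ha, hE k b hb, hE k t (hI.out ha hb ht)]
  refine hC k (fun s => (E.truncOp k ^ n) (E.truncProj k (y s))) (fun s hs => ?_) a t b
    (hI_sub ha) ht.1 ht.2
  have := hA.hasDerivWithinAt_truncOp_pow hy k n hs
  rwa [pow_succ'] at this

end IsSpectralMeasureOf

end Gevrey

/-! ### Comparison of the Gevrey classes. -/

theorem proposition3p1 {X : Type*} [NormedAddCommGroup X] [NormedSpace ℂ X] [CompleteSpace X]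
    (A : X →ₗ.[ℂ] X) (E : Gevrey.SpectralMeasure X) (hA : Gevrey.IsSpectralMeasureOf E A)
    (β : ℝ) (hβ : 0 ≤ β)
    (I : Set ℝ) (hI : I.OrdConnected) (hI_nontrivial : I.Nontrivial) (hI_sub : I ⊆ Set.Ici 0)
    (y : ℝ → X) (hy : Gevrey.IsWeakSolution A y) :
    ((y ∈ Gevrey.gevreyRoumieuOn β I ↔ ∀ t ∈ I, y t ∈ Gevrey.gevreyRoumieuVec β A) ∧
      (y ∈ Gevrey.gevreyRoumieuOn β I → ∀ n : ℕ, ∀ t ∈ I,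
        ∃ h : y t ∈ (Gevrey.opPow A n).domain,
          iteratedDerivWithin n y I t = Gevrey.opPow A n ⟨y t, h⟩)) ∧
    ((y ∈ Gevrey.gevreyBeurlingOn β I ↔ ∀ t ∈ I, y t ∈ Gevrey.gevreyBeurlingVec β A) ∧
      (y ∈ Gevrey.gevreyBeurlingOn β I → ∀ n : ℕ, ∀ t ∈ I,
        ∃ h : y t ∈ (Gevrey.opPow A n).domain,
          iteratedDerivWithin n y I t = Gevrey.opPow A n ⟨y t, h⟩)) := by
  have hgraph (hs : ContDiffOn ℝ ∞ y I) (t : ℝ) (ht : t ∈ I) (n : ℕ) :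
      (y t, iteratedDerivWithin n y I t) ∈ (Gevrey.opPow A n).graph :=
    hA.mem_graph_opPow_iteratedDerivWithin hy
      (Gevrey.uniqueDiffOn_of_ordConnected hI hI_nontrivial) hI_sub hs n ht
  have hpow (hs : ContDiffOn ℝ ∞ y I) (n : ℕ) (t : ℝ) (ht : t ∈ I) :
      ∃ h : y t ∈ (Gevrey.opPow A n).domain,
        iteratedDerivWithin n y I t = Gevrey.opPow A n ⟨y t, h⟩ := by
    obtain ⟨h, h'⟩ := Gevrey.exists_apply_eq_of_mem_graph (hgraph hs t ht n)
    exact ⟨h, h'.symm⟩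
  -- The degenerate interval `[t, t]` turns bounds on functions into bounds at the vector `y t`.
  have hIcc {t : ℝ} (ht : t ∈ I) : Icc t t ⊆ I := by simpa using ht
  refine ⟨⟨⟨fun h t ht => ?_, fun h => ?_⟩, fun h => hpow h.1⟩,
    ⟨⟨fun h t ht => ?_, fun h => ?_⟩, fun h => hpow h.1⟩⟩
  · rw [Gevrey.mem_gevreyRoumieuVec_iff (hgraph h.1 t ht)]
    obtain ⟨α, hα, c, hc, hb⟩ := h.2 t t (hIcc ht)
    exact ⟨α, hα, c, hc, fun n => hb n t ⟨le_rfl, le_rfl⟩⟩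
  · have hs := hA.contDiffOn_of_mem_domain_opPow hy hI hI_nontrivial hI_sub
      fun n t ht => (h t ht).1 n
    obtain ⟨C, hC, hbound⟩ := hA.exists_norm_iteratedDerivWithin_le hy hI hI_nontrivial hI_sub hs
    refine ⟨hs, fun a b hab => ?_⟩
    -- For `b < a` the interval is empty and any constants do.
    rcases lt_or_ge b a with hba | hba
    · exact ⟨1, one_pos, 1, one_pos, fun n t ht => absurd (ht.1.trans ht.2) hba.not_ge⟩
    have ha : a ∈ I := hab ⟨le_rfl, hba⟩
    have hb : b ∈ I := hab ⟨hba, le_rfl⟩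
    obtain ⟨α₁, hα₁, c₁, hc₁, h₁⟩ := (Gevrey.mem_gevreyRoumieuVec_iff (hgraph hs a ha)).1 (h a ha)
    obtain ⟨α₂, hα₂, c₂, hc₂, h₂⟩ := (Gevrey.mem_gevreyRoumieuVec_iff (hgraph hs b hb)).1 (h b hb)
    refine ⟨max α₁ α₂, lt_max_of_lt_left hα₁, C * (c₁ + c₂), by positivity, fun n t ht => ?_⟩
    calc ‖iteratedDerivWithin n y I t‖
        ≤ C * (‖iteratedDerivWithin n y I a‖ + ‖iteratedDerivWithin n y I b‖) :=
          hbound n a ha b hb t ht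
      _ ≤ C * (c₁ * max α₁ α₂ ^ n * (n.factorial : ℝ) ^ β +
            c₂ * max α₁ α₂ ^ n * (n.factorial : ℝ) ^ β) := by
          gcongr
          · exact (h₁ n).trans (by gcongr; exact le_max_left _ _)
          · exact (h₂ n).trans (by gcongr; exact le_max_right _ _)
      _ = C * (c₁ + c₂) * max α₁ α₂ ^ n * (n.factorial : ℝ) ^ β := by ring
  · rw [Gevrey.mem_gevreyBeurlingVec_iff (hgraph h.1 t ht)]
    intro α hα
    obtain ⟨c, hc, hb⟩ := h.2 t t (hIcc ht) α hα
    exact ⟨c, hc, fun n => hb n t ⟨le_rfl, le_rfl⟩⟩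
  · have hs := hA.contDiffOn_of_mem_domain_opPow hy hI hI_nontrivial hI_sub
      fun n t ht => (h t ht).1 n
    obtain ⟨C, hC, hbound⟩ := hA.exists_norm_iteratedDerivWithin_le hy hI hI_nontrivial hI_sub hs
    refine ⟨hs, fun a b hab α hα => ?_⟩
    rcases lt_or_ge b a with hba | hba
    · exact ⟨1, one_pos, fun n t ht => absurd (ht.1.trans ht.2) hba.not_ge⟩
    have ha : a ∈ I := hab ⟨le_rfl, hba⟩
    have hb : b ∈ I := hab ⟨hba, le_rfl⟩
    obtain ⟨c₁, hc₁, h₁⟩ := (Gevrey.mem_gevreyBeurlingVec_iff (hgraph hs a ha)).1 (h a ha) α hα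
    obtain ⟨c₂, hc₂, h₂⟩ := (Gevrey.mem_gevreyBeurlingVec_iff (hgraph hs b hb)).1 (h b hb) α hα
    refine ⟨C * (c₁ + c₂), by positivity, fun n t ht => ?_⟩
    calc ‖iteratedDerivWithin n y I t‖
        ≤ C * (‖iteratedDerivWithin n y I a‖ + ‖iteratedDerivWithin n y I b‖) :=
          hbound n a ha b hb t ht
      _ ≤ C * (c₁ * α ^ n * (n.factorial : ℝ) ^ β + c₂ * α ^ n * (n.factorial : ℝ) ^ β) := by
          gcongr
          · exact h₁ n
          · exact h₂ n
      _ = C * (c₁ + c₂) * α ^ n * (n.factorial : ℝ) ^ β := by ring
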